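/- Definitions. A finite set $S\subseteq\mathbb{R}^d$ is in general position if, for every $j=1,\dots,d-1$, no $j+2$ points of $S$ lie in a $j$-dimensional affine subspace. It is in strongly general position if moreover, for every $i=1,\dots,d-1$, no $i+1$ points of $S$ span an affine subspace parallel to the linear subspace spanned by the last $d-i$ coordinate axes (two subspaces are parallel if the direction space of one contains that of the other). Let $\pi:\mathbb{R}^d\to\mathbb{R}^{d-1}$ be the projection that forgets the last coordinate. If $Q=\{q_0,\dots,q_{n-1}\}$ is in strongly general position and ordered by increasing first coordinate, put $Q_{i,m}=\{q_j : j\equiv i \pmod m\}$. For sets $A,B$ in strongly general position with $|A|,|B|\ge d$, $B$ is deep below $A$ if $B$ lies strictly below every hyperplane determined by $d$ points of $A$ and $A$ lies strictly above every hyperplane determined by $d$ points of $B$ ("below" and "above" refer to the last coordinate). For arbitrary finite sets $A',B'$, $B'$ is deep below $A'$ if there are finite sets $A\supseteq A'$ and $B\supseteq B'$ in strongly general position with $|A|,|B|\ge d$ such that $B$ is deep below $A$. Let $p_2=2,\ p_3=3,\ p_4=5,\dots$ be the sequence of all primes. Every finite subset of $\mathbb{R}$ is a $1$-dimensional Horton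 set. For $d\ge 2$, a finite set $H\subseteq\mathbb{R}^d$ in strongly general position is a $d$-dimensional Horton set if either $|H|\le 1$, or all of the following hold: (i) if $d>2$, then $\pi(H)$ is a $(d-1)$-dimensional Horton set; (ii) $H_{i,p_d}$ is a $d$-dimensional Horton set for every $i\in\{0,\dots,p_d-1\}$; (iii) every $I\subseteq\{0,\dots,p_d-1\}$ with $|I|\ge 2$ can be partitioned into two nonempty subsets $J$ and $I\setminus J$ such that $\bigcup_{j\in J}H_{j,p_d}$ is deep below $\bigcup_{i\in I\setminus J}H_{i,p_d}$. A $k$-island in $S$ is a set $I\subseteq S$ of $k$ points with $\operatorname{conv}(I)\cap S=I$. A $k$-hole in $S$ is a set of $k$ points of $S$ in convex position such that the interior of its convex hull contains no point of $S$. Theorem. Let $d\ge 2$ and $k\ge 1$ be integers. There are a constant $c>0$ and an integer $n_0$, depending only on $d$ and $k$, such that every $d$-dimensional Horton set $H$ with $n\ge n_0$ points contains at least $c\,n^{\min\{2^{d-1},k\}}$ $k$-islands in $H$. If moreover $k\le 3\cdot 2^{d-1}$, then there are a constant $c>0$ and an integer $n_0$, depending only on $d$ and $k$, such that every $d$-dimensional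 Horton set $H$ with $n\ge n_0$ points contains at least $c\,n^{\min\{2^{d-1},k\}}$ $k$-holes in $H$. -/

import Mathlib

/-! Points of `ℝ^d` are functions `Fin d → ℝ`; coordinate number `j` of the usual numbering
`1, …, d` is the index `j - 1`. -/

namespace HortonSets

/-- `S ⊆ ℝ^d` is in general position: for every `k = 1, …, d - 1`, no `k + 2` points of `S` lie in
a `k`-dimensional affine subspace. -/
def GeneralPosition {d : ℕ} (S : Finset (Fin d → ℝ)) : Prop :=
  ∀ k : ℕ, 1 ≤ k → k + 1 ≤ d → ∀ T ⊆ S, T.card = k + 2 →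
    ∀ V : AffineSubspace ℝ (Fin d → ℝ), Module.finrank ℝ V.direction = k →
      ¬ ((T : Set (Fin d → ℝ)) ⊆ (V : Set (Fin d → ℝ)))

/-- The `(d - i)`-dimensional linear subspace of `ℝ^d` containing the last `d - i` axes. -/
def lastAxes (d i : ℕ) : Submodule ℝ (Fin d → ℝ) where
  carrier := {x | ∀ j : Fin d, (j : ℕ) < i → x j = 0}
  add_mem' := by
    intro a b ha hb j hj
    simp [ha j hj, hb j hj]
  zero_mem' := by
    intro j _
    rfl
  smul_mem' := by
    intro c x hx j hj
    simp [hx j hj]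

/-- Two linear (direction) subspaces are parallel: one of them contains the other. -/
def Parallel {d : ℕ} (U W : Submodule ℝ (Fin d → ℝ)) : Prop := U ≤ W ∨ W ≤ U

/-- Strongly general position: general position and, for every `i = 1, …, d - 1`, no `i + 1` points
span an affine subspace parallel to the linear subspace containing the last `d - i` axes.
(In general position, `i + 1` points with `i < d` do span an `i`-dimensional subspace.) -/
def StronglyGeneralPosition {d : ℕ} (S : Finset (Fin d → ℝ)) : Prop :=
  GeneralPosition S ∧
    ∀ i : ℕ, 1 ≤ i → i + 1 ≤ d → ∀ T ⊆ S, T.card = i + 1 →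
      ¬ Parallel (vectorSpan ℝ (T : Set (Fin d → ℝ))) (lastAxes d i)

/-- The projection `π : ℝ^(d+1) → ℝ^d` forgetting the last coordinate. -/
def proj {d : ℕ} (x : Fin (d + 1) → ℝ) : Fin d → ℝ := fun j => x j.castSucc

/-- The position `0, 1, …, |Q| - 1` of `q` in `Q` when `Q` is ordered by increasing first
coordinates. -/
noncomputable def rank {d : ℕ} (Q : Finset (Fin (d + 1) → ℝ)) (q : Fin (d + 1) → ℝ) : ℕ :=
  (Q.filter fun p => p 0 < q 0).card

/-- `Q_{i,m}`: the points of `Q` whose position (by first coordinate) is `i` modulo `m`. -/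
noncomputable def residueClass {d : ℕ} (Q : Finset (Fin (d + 1) → ℝ)) (i m : ℕ) :
    Finset (Fin (d + 1) → ℝ) :=
  Q.filter fun q => rank Q q ≡ i [MOD m]

/-- `x` lies (strictly) below the non-vertical hyperplane `h`. -/
def Below {d : ℕ} (x : Fin (d + 1) → ℝ) (h : AffineSubspace ℝ (Fin (d + 1) → ℝ)) : Prop :=
  ∃ y ∈ h, proj y = proj x ∧ x (Fin.last d) < y (Fin.last d)

/-- `x` lies (strictly) above the non-vertical hyperplane `h`. -/
def Above {d : ℕ} (x : Fin (d + 1) → ℝ) (h : AffineSubspace ℝ (Fin (d + 1) → ℝ)) : Prop :=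
  ∃ y ∈ h, proj y = proj x ∧ y (Fin.last d) < x (Fin.last d)

/-- `B` is deep below `A`, for sets of at least `d + 1` points of `ℝ^(d+1)` in strongly general
position (so that any `d + 1` points of one of them determine a non-vertical hyperplane). -/
def DeepBelowLarge {d : ℕ} (B A : Finset (Fin (d + 1) → ℝ)) : Prop :=
  StronglyGeneralPosition A ∧ StronglyGeneralPosition B ∧ d + 1 ≤ A.card ∧ d + 1 ≤ B.card ∧
    (∀ T ⊆ A, T.card = d + 1 →
      ∀ b ∈ B, Below b (affineSpan ℝ (T : Set (Fin (d + 1) → ℝ)))) ∧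
    (∀ T ⊆ B, T.card = d + 1 →
      ∀ a ∈ A, Above a (affineSpan ℝ (T : Set (Fin (d + 1) → ℝ))))

/-- `B'` is deep below `A'`, for finite point sets of arbitrary size: they can be enlarged to sets
`B` and `A` of at least `d + 1` points of `ℝ^(d+1)` such that `B` is deep below `A`. -/
def DeepBelow {d : ℕ} (B' A' : Finset (Fin (d + 1) → ℝ)) : Prop :=
  ∃ A B : Finset (Fin (d + 1) → ℝ), A' ⊆ A ∧ B' ⊆ B ∧ DeepBelowLarge B A

/-- The primes `p_2 = 2`, `p_3 = 3`, `p_4 = 5`, …: `p_d` is the `(d - 1)`-st prime. -/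
noncomputable def hortonPrime (d : ℕ) : ℕ := Nat.nth Nat.Prime (d - 2)

/-- `IsHorton d H`: the finite set `H ⊆ ℝ^d` is a `d`-Horton set. -/
inductive IsHorton : (d : ℕ) → Finset (Fin d → ℝ) → Prop
  /-- Every finite set of points of `ℝ` is `1`-Horton. -/
  | one (H : Finset (Fin 1 → ℝ)) : IsHorton 1 H
  /-- The empty set and the one-point sets. -/
  | small {d : ℕ} (H : Finset (Fin (d + 2) → ℝ)) (gp : StronglyGeneralPosition H)
      (card_le : H.card ≤ 1) : IsHorton (d + 2) H
  /-- The recursive condition in dimension `d + 2`. -/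
  | step {d : ℕ} (H : Finset (Fin (d + 2) → ℝ)) (gp : StronglyGeneralPosition H)
      (proj_horton : 2 < d + 2 → IsHorton (d + 1) (H.image proj))
      (class_horton : ∀ i < hortonPrime (d + 2),
        IsHorton (d + 2) (residueClass H i (hortonPrime (d + 2))))
      (deep : ∀ I ⊆ Finset.range (hortonPrime (d + 2)), 2 ≤ I.card →
        ∃ J ⊆ I, J.Nonempty ∧ (I \ J).Nonempty ∧
          DeepBelow (J.biUnion fun j => residueClass H j (hortonPrime (d + 2)))
            ((I \ J).biUnion fun i => residueClass H i (hortonPrime (d + 2)))) :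
      IsHorton (d + 2) H

/-- `I` is a `k`-island in `S`. -/
def IsIsland {d : ℕ} (k : ℕ) (S I : Finset (Fin d → ℝ)) : Prop :=
  I ⊆ S ∧ I.card = k ∧
    convexHull ℝ (I : Set (Fin d → ℝ)) ∩ (S : Set (Fin d → ℝ)) = (I : Set (Fin d → ℝ))

/-- `I` is a `k`-hole in `S`: `k` points of `S` in convex position such that the interior of their
convex hull contains no point of `S`. -/
def IsHole {d : ℕ} (k : ℕ) (S I : Finset (Fin d → ℝ)) : Prop :=
  I ⊆ S ∧ I.card = k ∧
    ConvexIndependent ℝ (fun x : (I : Set (Fin d → ℝ)) => (x : Fin d → ℝ)) ∧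
    interior (convexHull ℝ (I : Set (Fin d → ℝ))) ∩ (S : Set (Fin d → ℝ)) = ∅

open Classical in
/-- The number of `k`-islands in `S`. -/
noncomputable def numIslands {d : ℕ} (k : ℕ) (S : Finset (Fin d → ℝ)) : ℕ :=
  (S.powerset.filter fun I => IsIsland k S I).card

open Classical in
/-- The number of `k`-holes in `S`. -/
noncomputable def numHoles {d : ℕ} (k : ℕ) (S : Finset (Fin d → ℝ)) : ℕ :=
  (S.powerset.filter fun I => IsHole k S I).card

end HortonSets

namespace HortonSets

/-! Each added dimension doubles the exponent. Splitting the residue classes repeatedly by condition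
(iii) ends with two classes, `B` deep below `A`, such that each other class lies on one side of all
hyperplanes determined by some large superset of `B ∪ A` (`exists_adjacent_pair`). Hulls of subsets
of `B ∪ A` therefore miss the other classes.

For `I ⊆ B` and `J ⊆ A`, the set `A` acts on `B` like a point at infinity straight up: a point of
`B` in the hull of `I ∪ J` already lies on or above the hull of `I` (`Separated.mem_shadow`), and
symmetrically for `A`. So `I ∪ J` is an island once `I` is one for upward shadows and `J` for
downward shadows (`DeepBelow.isGood_union`). Both choices are free and the classes have linear size,
so sizes and exponents add (`Many.good_of_shadowGood`). Shadow conditions follow from ordinary ones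
for the projection, a Horton set one dimension lower (`Many.shadowGood_of_good`).

In the plane, linearly many blocks of `k` consecutive points are shadow islands
(`isShadowGood_block`). With at most three points and the right parity they are also in convex
position for shadows; the bound 3 doubles along with the exponent. The proposition `c` switches
convex position on, and an island in convex position is a hole (`IsGood.isHole`). -/

/-! ### Non-vertical hyperplanes and strongly general position. -/

/-- The vertical unit vector of `ℝ^(d+1)`. -/
noncomputable def vert (d : ℕ) : Fin (d + 1) → ℝ := Pi.single (Fin.last d) 1

theorem eq_add_smul_vert {d : ℕ} {x y : Fin (d + 1) → ℝ} (h : proj y = proj x) :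
    y = x + (y (Fin.last d) - x (Fin.last d)) • vert d := by
  funext j
  refine Fin.lastCases ?_ (fun i => ?_) j
  · simp [vert]
  · have := congrFun h i
    simpa [proj, vert, Fin.castSucc_ne_last] using this

theorem exists_submodule_finrank_eq {E : Type*} [AddCommGroup E] [Module ℝ E]
    [FiniteDimensional ℝ E] {k : ℕ} (hk : k ≤ Module.finrank ℝ E) (U : Submodule ℝ E)
    (hU : Module.finrank ℝ U ≤ k) : ∃ W, U ≤ W ∧ Module.finrank ℝ W = k := by
  induction k with
  | zero => exact ⟨U, le_rfl, by omega⟩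
  | succ k ih =>
    rcases Nat.lt_or_ge (Module.finrank ℝ U) (k + 1) with h | h
    · obtain ⟨W, hUW, hW⟩ := ih (by omega) (by omega)
      obtain ⟨v, hv⟩ := W.exists_of_finrank_lt (by omega)
      have hvW : v ∉ W := by simpa using hv 1 one_ne_zero
      refine ⟨W ⊔ Submodule.span ℝ {v}, hUW.trans le_sup_left, le_antisymm ?_ ?_⟩
      · have h1 := Submodule.finrank_add_le_finrank_add_finrank W (Submodule.span ℝ {v})
        have h2 : Module.finrank ℝ (Submodule.span ℝ {v}) ≤ 1 :=
          (finrank_span_le_card {v}).trans (by simp)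
        omega
      · have : W < W ⊔ Submodule.span ℝ {v} := by
          refine lt_of_le_of_ne le_sup_left fun h => hvW ?_
          rw [h]
          exact Submodule.mem_sup_right (Submodule.mem_span_singleton_self v)
        have := Submodule.finrank_lt_finrank_of_lt this
        omega
    · exact ⟨U, le_rfl, by omega⟩

theorem lastAxes_le_of_vert_mem {d : ℕ} {U : Submodule ℝ (Fin (d + 1) → ℝ)} (h : vert d ∈ U) :
    lastAxes (d + 1) d ≤ U := by
  intro x hx
  have : x = x (Fin.last d) • vert d := by
    funext j
    refine Fin.lastCases ?_ (fun i => ?_) j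
    · simp [vert]
    · have := hx i.castSucc (by simp)
      simp [vert, Fin.castSucc_ne_last, this]
  rw [this]
  exact U.smul_mem _ h

theorem StronglyGeneralPosition.vectorSpan_sup_vert {d : ℕ} (hd : 1 ≤ d)
    {S : Finset (Fin (d + 1) → ℝ)} (hS : StronglyGeneralPosition S)
    {T : Finset (Fin (d + 1) → ℝ)} (hTS : T ⊆ S) (hT : T.card = d + 1) :
    vectorSpan ℝ (T : Set (Fin (d + 1) → ℝ)) ⊔ Submodule.span ℝ {vert d} = ⊤ := by
  have hpar := hS.2 d hd le_rfl T hTS hT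
  simp only [Parallel, not_or] at hpar
  obtain ⟨t, ht⟩ : T.Nonempty := Finset.card_pos.1 (by omega)
  have hrank : d ≤ Module.finrank ℝ (vectorSpan ℝ (T : Set (Fin (d + 1) → ℝ))) := by
    by_contra! hlt
    rcases Nat.lt_or_ge 1 d with h1 | h1
    · obtain ⟨W, hW, hWr⟩ := exists_submodule_finrank_eq (k := d - 1) (by simp; omega)
        (vectorSpan ℝ (T : Set (Fin (d + 1) → ℝ))) (by omega)
      refine hS.1 (d - 1) (by omega) (by omega) T hTS (by omega) (AffineSubspace.mk' t W)
        (by rw [AffineSubspace.direction_mk', hWr]) ?_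
      intro x hx
      rw [SetLike.mem_coe, AffineSubspace.mem_mk']
      exact hW (vsub_mem_vectorSpan ℝ hx ht)
    -- Here `d = 1`: general position does not cover subspaces of dimension 0, but the zero
    -- direction space is parallel to everything.
    · apply hpar.1
      have : vectorSpan ℝ (T : Set (Fin (d + 1) → ℝ)) = ⊥ :=
        Submodule.finrank_eq_zero.1 (by omega)
      rw [this]
      exact bot_le
  have hlt : vectorSpan ℝ (T : Set (Fin (d + 1) → ℝ)) <
      vectorSpan ℝ (T : Set (Fin (d + 1) → ℝ)) ⊔ Submodule.span ℝ {vert d} := by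
    refine lt_of_le_of_ne le_sup_left fun h => hpar.2 (lastAxes_le_of_vert_mem ?_)
    rw [h]
    exact Submodule.mem_sup_right (Submodule.mem_span_singleton_self _)
  have h1 := Submodule.finrank_lt_finrank_of_lt hlt
  have h2 := Submodule.finrank_le
    (vectorSpan ℝ (T : Set (Fin (d + 1) → ℝ)) ⊔ Submodule.span ℝ {vert d})
  apply Submodule.eq_top_of_finrank_eq
  simp only [Module.finrank_fintype_fun_eq_card, Fintype.card_fin] at h2 ⊢
  omega

theorem StronglyGeneralPosition.injOn_zero {d : ℕ} (hd : 1 ≤ d)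
    {S : Finset (Fin (d + 1) → ℝ)} (hS : StronglyGeneralPosition S) :
    ∀ a ∈ S, ∀ b ∈ S, a 0 = b 0 → a = b := by
  intro a ha b hb hab
  by_contra hne
  refine hS.2 1 le_rfl (by omega) {a, b} (by grind) (Finset.card_pair hne) (Or.inl ?_)
  rw [vectorSpan_def, Submodule.span_le]
  rintro _ ⟨x, hx, y, hy, rfl⟩ j hj
  have hj0 : j = 0 := Fin.ext (by simpa using hj)
  subst hj0
  simp only [Finset.coe_insert, Finset.coe_singleton, Set.mem_insert_iff,
    Set.mem_singleton_iff] at hx hy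
  rcases hx with rfl | rfl <;> rcases hy with rfl | rfl <;> simp [hab]

/-- Extend `T` to `d` points avoiding `p`. Adding `p` and the vertical direction to them spans
everything, so the vertical hyperplane through them misses `p`; `m` is its equation. -/
theorem StronglyGeneralPosition.exists_affineMap {d : ℕ} (hd : 1 ≤ d)
    {S : Finset (Fin (d + 1) → ℝ)} (hS : StronglyGeneralPosition S) (hcard : d + 1 ≤ S.card)
    {T : Finset (Fin (d + 1) → ℝ)} (hTS : T ⊆ S) (hT : T.card ≤ d) {p : Fin (d + 1) → ℝ}
    (hp : p ∈ S) (hpT : p ∉ T) :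
    ∃ m : (Fin (d + 1) → ℝ) →ᵃ[ℝ] ℝ, m.linear (vert d) = 0 ∧ (∀ t ∈ T, m t = 0) ∧ m p ≠ 0 := by
  classical
  rcases T.eq_empty_or_nonempty with rfl | ⟨t, ht⟩
  · exact ⟨AffineMap.const ℝ _ 1, by simp⟩
  obtain ⟨U, hTU, hUS, hU⟩ := Finset.exists_subsuperset_card_eq
    (show T ⊆ S.erase p from fun x hx => by grind) hT
    (by rw [Finset.card_erase_of_mem hp]; omega)
  have hpU : p ∉ U := fun h => by simpa using hUS h
  have htop := hS.vectorSpan_sup_vert hd (T := insert p U)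
    (Finset.insert_subset hp (hUS.trans (Finset.erase_subset _ _)))
    (by rw [Finset.card_insert_of_notMem hpU, hU])
  set W := vectorSpan ℝ (U : Set (Fin (d + 1) → ℝ)) ⊔ Submodule.span ℝ {vert d} with hW
  have hpW : p - t ∉ W := by
    intro hmem
    have hle : vectorSpan ℝ ((insert p U : Finset _) : Set (Fin (d + 1) → ℝ)) ≤ W := by
      rw [vectorSpan_eq_span_vsub_set_right ℝ (p := t) (by simp [hTU ht]), Submodule.span_le]
      rintro _ ⟨x, hx, rfl⟩
      rw [Finset.coe_insert] at hx
      rcases hx with rfl | hx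
      · exact hmem
      · exact Submodule.mem_sup_left (vsub_mem_vectorSpan ℝ hx (hTU ht))
    have hWtop : W = ⊤ := by
      rw [eq_top_iff, ← htop]
      exact sup_le hle le_sup_right
    have h1 := Submodule.finrank_add_le_finrank_add_finrank
      (vectorSpan ℝ (U : Set (Fin (d + 1) → ℝ))) (Submodule.span ℝ {vert d})
    rw [← hW, hWtop, finrank_top] at h1
    have h2 : Module.finrank ℝ (Submodule.span ℝ {vert d}) ≤ 1 :=
      (finrank_span_le_card {vert d}).trans (by simp)
    have h3 := finrank_vectorSpan_image_finset_le ℝ (id : (Fin (d + 1) → ℝ) → _) U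
      (n := d - 1) (by omega)
    rw [Finset.coe_image, Set.image_id] at h3
    simp only [Module.finrank_fintype_fun_eq_card, Fintype.card_fin] at h1
    omega
  obtain ⟨f, hf, hker⟩ := Submodule.exists_le_ker_of_notMem hpW
  refine ⟨f.toAffineMap - AffineMap.const ℝ _ (f t), ?_, ?_, ?_⟩
  · have : vert d ∈ W := Submodule.mem_sup_right (Submodule.mem_span_singleton_self _)
    simpa using hker this
  · intro x hx
    have : x - t ∈ W := Submodule.mem_sup_left (vsub_mem_vectorSpan ℝ (hTU hx) (hTU ht))
    simpa using hker this
  · simpa using hf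

/-- Tilt the hyperplane about the points of `S` on it, keeping it non-vertical, and stop when it
first hits another point of `S`; until then no point changes sides. -/
theorem StronglyGeneralPosition.exists_more_zeros {d : ℕ} (hd : 1 ≤ d)
    {S : Finset (Fin (d + 1) → ℝ)} (hS : StronglyGeneralPosition S) (hcard : d + 1 ≤ S.card)
    (φ : (Fin (d + 1) → ℝ) →ᵃ[ℝ] ℝ) (hφ : 0 < φ.linear (vert d))
    (hz : (S.filter fun p => φ p = 0).card ≤ d) :
    ∃ ψ : (Fin (d + 1) → ℝ) →ᵃ[ℝ] ℝ, 0 < ψ.linear (vert d) ∧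
      (∀ p ∈ S, (0 ≤ φ p → 0 ≤ ψ p) ∧ (φ p ≤ 0 → ψ p ≤ 0)) ∧
      (S.filter fun p => φ p = 0).card < (S.filter fun p => ψ p = 0).card := by
  obtain ⟨p, hpS, hp⟩ := Finset.exists_mem_notMem_of_card_lt_card
    (show (S.filter fun p => φ p = 0).card < S.card by omega)
  obtain ⟨m, hmv, hmT, hmp⟩ := hS.exists_affineMap hd hcard (Finset.filter_subset _ _) hz hpS hp
  have hφp : φ p ≠ 0 := fun h => hp (by simp [hpS, h])
  -- Scaled so that `φ + n` vanishes at `p`: some point is hit in finite time.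
  set n : (Fin (d + 1) → ℝ) →ᵃ[ℝ] ℝ := (-(φ p / m p)) • m with hn
  have hnp : n p = -φ p := by
    simp [hn, hmp]
  have hnv : n.linear (vert d) = 0 := by simp [hn, hmv]
  have hnT : ∀ q ∈ S, φ q = 0 → n q = 0 := by
    intro q hq h
    simp [hn, hmT q (by simp [hq, h])]
  let R := S.filter fun q => φ q * n q < 0
  have hpR : p ∈ R := by
    simp only [R, Finset.mem_filter, hnp]
    refine ⟨hpS, ?_⟩
    have := mul_self_pos.2 hφp
    linarith
  obtain ⟨q, hqR, hqmin⟩ := R.exists_min_image (fun q => -φ q / n q) ⟨p, hpR⟩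
  obtain ⟨hqS, hq⟩ := Finset.mem_filter.1 hqR
  have hnq : n q ≠ 0 := fun h => by simp [h] at hq
  have hφq : φ q ≠ 0 := fun h => by simp [h] at hq
  set s := -φ q / n q with hs
  have hspos : 0 < s := by
    have : s = -(φ q * n q) / (n q * n q) := by
      rw [hs]; field_simp
    rw [this]
    exact div_pos (by linarith) (mul_self_pos.2 hnq)
  have hval : ∀ x, (φ + s • n) x = φ x + s * n x := fun x => by simp
  refine ⟨φ + s • n, by simpa [hnv] using hφ, ?_, ?_⟩
  · intro x hx
    rw [hval]
    rcases lt_trichotomy (φ x) 0 with h | h | h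
    · refine ⟨fun h' => absurd h' (not_le.2 h), fun _ => ?_⟩
      rcases le_or_gt (n x) 0 with h' | h'
      · nlinarith
      · have := hqmin x (by simp [R, hx]; nlinarith)
        have := (le_div_iff₀ h').1 this
        linarith
    · simp [h, hnT x hx h]
    · refine ⟨fun _ => ?_, fun h' => absurd h' (not_le.2 h)⟩
      rcases le_or_gt 0 (n x) with h' | h'
      · nlinarith
      · have := hqmin x (by simp [R, hx]; nlinarith)
        have := (le_div_iff_of_neg h').1 this
        linarith
  · refine Finset.card_lt_card (Finset.ssubset_iff_of_subset ?_ |>.2 ⟨q, ?_, ?_⟩)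
    · intro x hx
      obtain ⟨hxS, hx0⟩ := Finset.mem_filter.1 hx
      rw [Finset.mem_filter, hval]
      exact ⟨hxS, by simp [hx0, hnT x hxS hx0]⟩
    · rw [Finset.mem_filter, hval]
      refine ⟨hqS, ?_⟩
      rw [hs]
      field_simp
      ring
    · simp [hφq]

/-- Any non-vertical hyperplane can be moved to a hyperplane determined by points of `S` so that no
point of `S` changes sides. -/
theorem StronglyGeneralPosition.exists_hyperplane {d : ℕ} (hd : 1 ≤ d)
    {S : Finset (Fin (d + 1) → ℝ)} (hS : StronglyGeneralPosition S) (hcard : d + 1 ≤ S.card)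
    (φ : (Fin (d + 1) → ℝ) →ᵃ[ℝ] ℝ) (hφ : 0 < φ.linear (vert d)) :
    ∃ ψ : (Fin (d + 1) → ℝ) →ᵃ[ℝ] ℝ, 0 < ψ.linear (vert d) ∧
      (∀ p ∈ S, (0 ≤ φ p → 0 ≤ ψ p) ∧ (φ p ≤ 0 → ψ p ≤ 0)) ∧
      ∃ T ⊆ S, T.card = d + 1 ∧ ∀ p ∈ T, ψ p = 0 := by
  -- Induction on the number of points of `S` off the hyperplane.
  induction h : S.card - (S.filter fun p => φ p = 0).card using Nat.strong_induction_on
    generalizing φ with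
  | _ n ih =>
    rcases Nat.lt_or_ge d (S.filter fun p => φ p = 0).card with hz | hz
    · obtain ⟨T, hT, hTc⟩ := Finset.exists_subset_card_eq (show d + 1 ≤ _ from hz)
      exact ⟨φ, hφ, fun p _ => ⟨id, id⟩, T, hT.trans (Finset.filter_subset _ _), hTc,
        fun p hp => (Finset.mem_filter.1 (hT hp)).2⟩
    · obtain ⟨χ, hχ, hsign, hlt⟩ := hS.exists_more_zeros hd hcard φ hφ hz
      have hle := Finset.card_filter_le S fun p => χ p = 0
      obtain ⟨ψ, hψ, hsign', hT⟩ := ih _ (by omega) χ hχ rfl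
      exact ⟨ψ, hψ, fun p hp => ⟨fun h => (hsign' p hp).1 ((hsign p hp).1 h),
        fun h => (hsign' p hp).2 ((hsign p hp).2 h)⟩, hT⟩

open scoped Pointwise

/-! ### Vertical shadows of convex hulls. -/

/-- The points lying on the `s`-side of `C`: above a point of `C` if `s = 1`, and below a point
of `C` if `s = -1`. -/
def shadow {d : ℕ} (s : ℝ) (C : Set (Fin (d + 1) → ℝ)) : Set (Fin (d + 1) → ℝ) :=
  {x | ∃ y ∈ C, proj y = proj x ∧ s * y (Fin.last d) ≤ s * x (Fin.last d)}

theorem proj_add_smul_vert {d : ℕ} (x : Fin (d + 1) → ℝ) (r : ℝ) :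
    proj (x + r • vert d) = proj x := by
  funext j
  simp [proj, vert, Fin.castSucc_ne_last]

/-- As the Minkowski sum with a vertical ray, a shadow inherits convexity, and it is closed when `C`
is compact. -/
theorem shadow_eq_add {d : ℕ} {s : ℝ} (hs : s = 1 ∨ s = -1) (C : Set (Fin (d + 1) → ℝ)) :
    shadow s C = (fun r : ℝ => (s * r) • vert d) '' Set.Ici 0 + C := by
  have hss : s * s = 1 := by rcases hs with rfl | rfl <;> norm_num
  ext x
  simp only [shadow, Set.mem_ofPred_eq, Set.mem_add, Set.mem_image, Set.mem_Ici]
  constructor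
  · rintro ⟨y, hy, hyx, hle⟩
    refine ⟨_, ⟨s * x (Fin.last d) - s * y (Fin.last d), by linarith, rfl⟩, y, hy, ?_⟩
    have h := eq_add_smul_vert hyx.symm
    rw [add_comm _ y, mul_sub, ← mul_assoc, ← mul_assoc, hss, one_mul, one_mul]
    exact h.symm
  · rintro ⟨_, ⟨r, hr, rfl⟩, y, hy, rfl⟩
    refine ⟨y, hy, ?_, ?_⟩
    · rw [add_comm, proj_add_smul_vert]
    · simp only [vert, Pi.add_apply, Pi.smul_apply, Pi.single_eq_same, smul_eq_mul, mul_one]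
      rw [mul_add, ← mul_assoc, hss]
      linarith

theorem isClosed_shadow_convexHull {d : ℕ} {s : ℝ} (hs : s = 1 ∨ s = -1)
    (I : Finset (Fin (d + 1) → ℝ)) :
    IsClosed (shadow s (convexHull ℝ (I : Set (Fin (d + 1) → ℝ)))) := by
  rw [shadow_eq_add hs]
  refine IsClosed.add_right_of_isCompact ?_ (I.finite_toSet.isCompact_convexHull ℝ)
  have hss : s * s = 1 := by rcases hs with rfl | rfl <;> norm_num
  have : (fun r : ℝ => (s * r) • vert d) '' Set.Ici 0 =
      {x | 0 ≤ s * x (Fin.last d)} ∩ {x | ∀ j : Fin d, x j.castSucc = 0} := by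
    ext x
    simp only [Set.mem_image, Set.mem_Ici, Set.mem_inter_iff, Set.mem_ofPred_eq]
    constructor
    · rintro ⟨r, hr, rfl⟩
      refine ⟨?_, fun j => by simp [vert, Fin.castSucc_ne_last]⟩
      simp only [vert, Pi.smul_apply, Pi.single_eq_same, smul_eq_mul, mul_one]
      rw [← mul_assoc, hss]
      linarith
    · rintro ⟨h0, hx⟩
      refine ⟨_, h0, ?_⟩
      rw [← mul_assoc, hss]
      funext j
      refine Fin.lastCases ?_ (fun i => ?_) j
      · simp [vert]
      · simp [vert, Fin.castSucc_ne_last, hx]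
  rw [this]
  refine (isClosed_le continuous_const (by fun_prop)).inter ?_
  rw [Set.ofPred_forall]
  exact isClosed_iInter fun j => isClosed_eq (by fun_prop) continuous_const

theorem convex_shadow {d : ℕ} {s : ℝ} (hs : s = 1 ∨ s = -1) {C : Set (Fin (d + 1) → ℝ)}
    (hC : Convex ℝ C) : Convex ℝ (shadow s C) := by
  rw [shadow_eq_add hs]
  refine Convex.add ?_ hC
  have : (fun r : ℝ => (s * r) • vert d) = ⇑((LinearMap.toSpanSingleton ℝ _ (s • vert d))) := by
    funext r
    simp [LinearMap.toSpanSingleton_apply, smul_smul, mul_comm]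
  rw [this]
  exact (convex_Ici 0).linear_image _

theorem subset_shadow {d : ℕ} (s : ℝ) (C : Set (Fin (d + 1) → ℝ)) : C ⊆ shadow s C :=
  fun x hx => ⟨x, hx, rfl, le_rfl⟩

/-- Hahn–Banach is applied to the shadow, not the hull: the rays in the shadow force the functional
to be nonnegative on `s • vert d`, and a small tilt makes it positive there. -/
theorem exists_separating {d : ℕ} {s : ℝ} (hs : s = 1 ∨ s = -1)
    {I : Finset (Fin (d + 1) → ℝ)} {q : Fin (d + 1) → ℝ}
    (hq : q ∉ shadow s (convexHull ℝ (I : Set (Fin (d + 1) → ℝ)))) :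
    ∃ φ : (Fin (d + 1) → ℝ) →ᵃ[ℝ] ℝ, 0 < φ.linear (vert d) ∧ (∀ p ∈ I, 0 < s * φ p) ∧
      s * φ q < 0 := by
  have hss : s * s = 1 := by rcases hs with rfl | rfl <;> norm_num
  rcases I.eq_empty_or_nonempty with rfl | ⟨p₀, hp₀⟩
  · refine ⟨(LinearMap.proj (Fin.last d) : (Fin (d + 1) → ℝ) →ₗ[ℝ] ℝ).toAffineMap -
      AffineMap.const ℝ _ (q (Fin.last d) + s), by simp [vert], by simp, ?_⟩
    simp [hss]
  obtain ⟨f, u, hfq, hfu⟩ := geometric_hahn_banach_point_closed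
    (convex_shadow hs (convex_convexHull ℝ _)) (isClosed_shadow_convexHull hs I) hq
  have hI : ∀ p ∈ I, u < f p := fun p hp =>
    hfu p (subset_shadow _ _ (subset_convexHull ℝ _ hp))
  have hfv : 0 ≤ s * f (vert d) := by
    by_contra! hneg
    obtain ⟨r, hr0, hr⟩ : ∃ r : ℝ, 0 ≤ r ∧ f p₀ + r * (s * f (vert d)) < u := by
      refine ⟨(f p₀ - u + 1) / -(s * f (vert d)), ?_, ?_⟩
      · have := hI p₀ hp₀
        exact div_nonneg (by linarith) (by linarith)
      · rw [div_mul_eq_mul_div, div_neg, mul_div_assoc, div_self hneg.ne]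
        linarith
    have hmem : (s * r) • vert d + p₀ ∈ shadow s (convexHull ℝ (I : Set (Fin (d + 1) → ℝ))) := by
      rw [shadow_eq_add hs]
      exact Set.add_mem_add ⟨r, hr0, rfl⟩ (subset_convexHull ℝ _ hp₀)
    have := hfu _ hmem
    simp only [map_add, map_smul, smul_eq_mul] at this
    nlinarith
  -- Tilt the separating hyperplane, which may be vertical.
  obtain ⟨ε, hε, hεI⟩ : ∃ ε : ℝ, 0 < ε ∧ ∀ p ∈ I,
      ε * (s * (q (Fin.last d) - p (Fin.last d))) < u - f q := by
    obtain ⟨M, hM⟩ := (I.image fun p => s * (q (Fin.last d) - p (Fin.last d))).bddAbove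
    refine ⟨(u - f q) / (|M| + 1), div_pos (by linarith) (by positivity), ?_⟩
    intro p hp
    have h1 : s * (q (Fin.last d) - p (Fin.last d)) ≤ M :=
      hM (Finset.mem_coe.2 (Finset.mem_image_of_mem _ hp))
    have h2 := le_abs_self M
    have h3 := abs_nonneg M
    rw [div_mul_eq_mul_div, div_lt_iff₀ (by linarith)]
    nlinarith
  obtain ⟨w, hw, hwI⟩ : ∃ w : ℝ, f q + ε * (s * q (Fin.last d)) < w ∧
      ∀ p ∈ I, w < f p + ε * (s * p (Fin.last d)) := by
    obtain ⟨p₁, hp₁, hmin⟩ :=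
      I.exists_min_image (fun p => f p + ε * (s * p (Fin.last d))) ⟨p₀, hp₀⟩
    have h1 := hεI p₁ hp₁
    have h2 := hI p₁ hp₁
    obtain ⟨w, hw1, hw2⟩ := exists_between
      (show f q + ε * (s * q (Fin.last d)) < f p₁ + ε * (s * p₁ (Fin.last d)) by nlinarith)
    exact ⟨w, hw1, fun p hp => hw2.trans_le (hmin p hp)⟩
  -- The factor `s` makes the vertical coefficient `s * f (vert d) + ε`, positive for both signs.
  refine ⟨(s • (f : (Fin (d + 1) → ℝ) →ₗ[ℝ] ℝ) + ε • LinearMap.proj (Fin.last d)).toAffineMap -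
    AffineMap.const ℝ _ (s * w), ?_, ?_, ?_⟩
  · have : (vert d) (Fin.last d) = 1 := by simp [vert]
    simp [this]
    linarith
  · intro p hp
    have := hwI p hp
    have h : s * (s * f p + ε * p (Fin.last d) - s * w) =
        (s * s) * f p + ε * (s * p (Fin.last d)) - (s * s) * w := by ring
    rw [hss] at h
    simp only [AffineMap.coe_sub, Pi.sub_apply, LinearMap.coe_toAffineMap, LinearMap.add_apply,
      LinearMap.smul_apply, smul_eq_mul, LinearMap.proj_apply, AffineMap.const_apply,
      ContinuousLinearMap.coe_coe]
    linarith
  · have h : s * (s * f q + ε * q (Fin.last d) - s * w) =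
        (s * s) * f q + ε * (s * q (Fin.last d)) - (s * s) * w := by ring
    rw [hss] at h
    simp only [AffineMap.coe_sub, Pi.sub_apply, LinearMap.coe_toAffineMap, LinearMap.add_apply,
      LinearMap.smul_apply, smul_eq_mul, LinearMap.proj_apply, AffineMap.const_apply,
      ContinuousLinearMap.coe_coe]
    linarith

/-! ### Separation by determined hyperplanes. -/

/-- `A` lies on the `s`-side of all hyperplanes determined by `B`. -/
def OnSide {d : ℕ} (s : ℝ) (B A : Finset (Fin (d + 1) → ℝ)) : Prop :=
  ∀ T ⊆ B, T.card = d + 1 → ∀ φ : (Fin (d + 1) → ℝ) →ᵃ[ℝ] ℝ, 0 < φ.linear (vert d) →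
    (∀ p ∈ T, φ p = 0) → ∀ a ∈ A, 0 < s * φ a

/-- `A` lies on the `s`-side of all hyperplanes determined by some large set containing `B`. -/
def Separated {d : ℕ} (s : ℝ) (B A : Finset (Fin (d + 1) → ℝ)) : Prop :=
  ∃ B', B ⊆ B' ∧ StronglyGeneralPosition B' ∧ d + 1 ≤ B'.card ∧ OnSide s B' A

theorem Separated.mono {d : ℕ} {s : ℝ} {B A B₁ A₁ : Finset (Fin (d + 1) → ℝ)}
    (h : Separated s B A) (hB : B₁ ⊆ B) (hA : A₁ ⊆ A) : Separated s B₁ A₁ := by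
  obtain ⟨B', hBB', hS, hc, ho⟩ := h
  exact ⟨B', hB.trans hBB', hS, hc, fun T hT hTc φ hφ h0 a ha => ho T hT hTc φ hφ h0 a (hA ha)⟩

theorem affineMap_eq_zero_of_mem_affineSpan {E : Type*} [AddCommGroup E] [Module ℝ E]
    {T : Set E} {φ : E →ᵃ[ℝ] ℝ} (h : ∀ p ∈ T, φ p = 0) {y : E} (hy : y ∈ affineSpan ℝ T) :
    φ y = 0 := by
  have : affineSpan ℝ T ≤ (affineSpan ℝ {(0 : ℝ)}).comap φ :=
    affineSpan_le.2 fun p hp => by simp [h p hp]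
  simpa using this hy

theorem affineMap_add_smul {E : Type*} [AddCommGroup E] [Module ℝ E] (φ : E →ᵃ[ℝ] ℝ) (x v : E)
    (r : ℝ) : φ (x + r • v) = φ x + r * φ.linear v := by
  rw [add_comm, ← vadd_eq_add, AffineMap.map_vadd]
  simp [add_comm]

theorem DeepBelow.separated {d : ℕ} {B A : Finset (Fin (d + 1) → ℝ)} (h : DeepBelow B A) :
    Separated 1 B A ∧ Separated (-1) A B := by
  obtain ⟨A', B', hA, hB, hSA, hSB, hcA, hcB, hbelow, habove⟩ := h
  constructor
  · refine ⟨B', hB, hSB, hcB, fun T hT hTc φ hφ h0 a ha => ?_⟩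
    obtain ⟨y, hy, hproj, hlt⟩ := habove T hT hTc a (hA ha)
    have hy0 := affineMap_eq_zero_of_mem_affineSpan h0 hy
    rw [eq_add_smul_vert hproj, affineMap_add_smul] at hy0
    nlinarith
  · refine ⟨A', hA, hSA, hcA, fun T hT hTc φ hφ h0 b hb => ?_⟩
    obtain ⟨y, hy, hproj, hlt⟩ := hbelow T hT hTc b (hB hb)
    have hy0 := affineMap_eq_zero_of_mem_affineSpan h0 hy
    rw [eq_add_smul_vert hproj, affineMap_add_smul] at hy0
    nlinarith

theorem convex_affineMap_nonneg {E : Type*} [AddCommGroup E] [Module ℝ E] (φ : E →ᵃ[ℝ] ℝ) (s : ℝ) :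
    Convex ℝ {x | 0 ≤ s * φ x} := by
  have := (convex_Ici (0 : ℝ)).affine_preimage (s • φ)
  simpa [Set.preimage, Set.Ici] using this

/-- A horizontal hyperplane with all of `B'` weakly on its `-s`-side moves to a determined one with
the same property. It has the `-s`-shadow of the hull on one side and `A` strictly on the other. -/
theorem Separated.notMem_shadow {d : ℕ} (hd : 1 ≤ d) {s : ℝ} (hs : s = 1 ∨ s = -1)
    {B A : Finset (Fin (d + 1) → ℝ)} (h : Separated s B A) {a : Fin (d + 1) → ℝ} (ha : a ∈ A) :
    a ∉ shadow (-s) (convexHull ℝ (B : Set (Fin (d + 1) → ℝ))) := by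
  obtain ⟨B', hB, hS, hc, ho⟩ := h
  obtain ⟨M, hM⟩ := (B'.image fun p => s * p (Fin.last d)).bddAbove
  have hss : s * s = 1 := by rcases hs with rfl | rfl <;> norm_num
  obtain ⟨ψ, hψ, hsign, T, hT, hTc, h0⟩ := hS.exists_hyperplane hd hc
    ((LinearMap.proj (Fin.last d) : (Fin (d + 1) → ℝ) →ₗ[ℝ] ℝ).toAffineMap -
      AffineMap.const ℝ _ (s * M)) (by simp [vert])
  have hneg : ∀ p ∈ B', 0 ≤ -s * ψ p := by
    intro p hp
    have hpM : s * p (Fin.last d) ≤ M := hM (Finset.mem_coe.2 (Finset.mem_image_of_mem _ hp))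
    have := hsign p hp
    simp only [AffineMap.coe_sub, Pi.sub_apply, LinearMap.coe_toAffineMap, LinearMap.proj_apply,
      AffineMap.const_apply] at this
    rcases hs with rfl | rfl
    · linarith [this.2 (by linarith)]
    · linarith [this.1 (by linarith)]
  rintro ⟨y, hy, hproj, hle⟩
  have h1 : 0 ≤ -s * ψ y :=
    convexHull_min (fun p hp => hneg p (hB hp)) (convex_affineMap_nonneg ψ (-s)) hy
  have h2 := ho T hT hTc ψ hψ h0 a ha
  rw [eq_add_smul_vert hproj.symm, affineMap_add_smul] at h2
  nlinarith

theorem Separated.notMem_convexHull {d : ℕ} (hd : 1 ≤ d) {s : ℝ} (hs : s = 1 ∨ s = -1)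
    {B A : Finset (Fin (d + 1) → ℝ)} (h : Separated s B A) {a : Fin (d + 1) → ℝ} (ha : a ∈ A) :
    a ∉ convexHull ℝ (B : Set (Fin (d + 1) → ℝ)) :=
  fun hmem => h.notMem_shadow hd hs ha (subset_shadow _ _ hmem)

/-- Otherwise a non-vertical hyperplane separates `q` from `I`. Moved to a determined one it still
does so weakly, and now `J` lies strictly on the side of `I`, so `q` could only be in the hull of
`I` itself. -/
theorem Separated.mem_shadow {d : ℕ} (hd : 1 ≤ d) {s : ℝ} (hs : s = 1 ∨ s = -1)
    {B A I J : Finset (Fin (d + 1) → ℝ)} (h : Separated s B A) (hI : I ⊆ B) (hJ : J ⊆ A)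
    {q : Fin (d + 1) → ℝ} (hq : q ∈ B)
    (hmem : q ∈ convexHull ℝ ((I : Set (Fin (d + 1) → ℝ)) ∪ J)) :
    q ∈ shadow s (convexHull ℝ (I : Set (Fin (d + 1) → ℝ))) := by
  by_contra hsh
  obtain ⟨φ, hφ, hφI, hφq⟩ := exists_separating hs hsh
  obtain ⟨B', hB, hS, hc, ho⟩ := h
  obtain ⟨ψ, hψ, hsign, T, hT, hTc, h0⟩ := hS.exists_hyperplane hd hc φ hφ
  have hsign' : ∀ p ∈ B', (0 ≤ s * φ p → 0 ≤ s * ψ p) ∧ (s * φ p ≤ 0 → s * ψ p ≤ 0) := by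
    intro p hp
    have := hsign p hp
    rcases hs with rfl | rfl
    · simpa using this
    · simpa using this.symm
  have hψI : ∀ p ∈ I, 0 ≤ s * ψ p := fun p hp => (hsign' p (hB (hI hp))).1 (hφI p hp).le
  have hψJ : ∀ p ∈ J, 0 < s * ψ p := fun p hp => ho T hT hTc ψ hψ h0 p (hJ hp)
  have hψq : s * ψ q ≤ 0 := (hsign' q (hB hq)).2 hφq.le
  have hIq : q ∉ convexHull ℝ (I : Set (Fin (d + 1) → ℝ)) := fun h => hsh (subset_shadow _ _ h)
  have hcI := convexHull_min (fun p hp => hψI p hp) (convex_affineMap_nonneg ψ s)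
  have hconv : Convex ℝ {x | 0 < s * ψ x} := by
    have := (convex_Ioi (0 : ℝ)).affine_preimage (s • ψ)
    simpa [Set.preimage, Set.Ioi] using this
  have hcJ := convexHull_min (fun p hp => hψJ p hp) hconv
  rcases J.eq_empty_or_nonempty with rfl | hJne
  · exact hIq (by simpa using hmem)
  rcases I.eq_empty_or_nonempty with rfl | hIne
  · have : 0 < s * ψ q := hcJ (by simpa using hmem)
    linarith
  rw [convexHull_union (by simpa using hIne) (by simpa using hJne), mem_convexJoin] at hmem
  obtain ⟨x, hx, y, hy, a, b, ha, hb, hab, rfl⟩ := hmem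
  have h1 : 0 ≤ s * ψ x := hcI hx
  have h2 : 0 < s * ψ y := hcJ hy
  have h3 : ψ (a • x + b • y) = a * ψ x + b * ψ y := by
    have := Convex.combo_affine_apply (f := ψ) (x := x) (y := y) hab
    simpa using this
  rw [h3] at hψq
  have hb0 : b = 0 := by
    by_contra hne
    have : 0 < b := lt_of_le_of_ne hb (Ne.symm hne)
    nlinarith [mul_nonneg ha h1, mul_pos this h2]
  have ha1 : a = 1 := by linarith
  simp [hb0, ha1] at hIq
  exact hIq hx

/-! ### Islands across a deep-below pair. -/

/-- `I` is an island in `S`, in convex position if `c` holds. -/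
def IsGood {d : ℕ} (c : Prop) (S I : Finset (Fin d → ℝ)) : Prop :=
  I ⊆ S ∧ (∀ q ∈ S, q ∈ convexHull ℝ (I : Set (Fin d → ℝ)) → q ∈ I) ∧
    (c → ∀ q ∈ I, q ∉ convexHull ℝ (I.erase q : Set (Fin d → ℝ)))

/-- Analogue of `IsGood` for the convex hull of `I` together with the point at infinity in the
direction `s • vert d`. -/
def IsShadowGood {d : ℕ} (s : ℝ) (c : Prop) (S I : Finset (Fin (d + 1) → ℝ)) : Prop :=
  I ⊆ S ∧ (∀ q ∈ S, q ∈ shadow s (convexHull ℝ (I : Set (Fin (d + 1) → ℝ))) → q ∈ I) ∧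
    (c → ∀ q ∈ I, q ∉ shadow s (convexHull ℝ (I.erase q : Set (Fin (d + 1) → ℝ))))

theorem DeepBelow.isGood_union {d : ℕ} (hd : 1 ≤ d) {c : Prop}
    {H B A I J : Finset (Fin (d + 1) → ℝ)} (h : DeepBelow B A) (hBH : B ⊆ H) (hAH : A ⊆ H)
    (hH : ∀ q ∈ H, q ∈ B ∨ q ∈ A ∨ ∃ s : ℝ, (s = 1 ∨ s = -1) ∧ Separated s (B ∪ A) {q})
    (hI : IsShadowGood 1 c B I) (hJ : IsShadowGood (-1) c A J) : IsGood c H (I ∪ J) := by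
  obtain ⟨hBA, hAB⟩ := h.separated
  obtain ⟨hIB, hIi, hIc⟩ := hI
  obtain ⟨hJA, hJi, hJc⟩ := hJ
  refine ⟨Finset.union_subset (hIB.trans hBH) (hJA.trans hAH), ?_, ?_⟩
  · intro q hq hmem
    rcases hH q hq with hqB | hqA | ⟨s, hs, hsep⟩
    · rw [Finset.coe_union] at hmem
      exact Finset.mem_union_left _
        (hIi q hqB (hBA.mem_shadow hd (Or.inl rfl) hIB hJA hqB hmem))
    · rw [Finset.coe_union, Set.union_comm] at hmem
      exact Finset.mem_union_right _
        (hJi q hqA (hAB.mem_shadow hd (Or.inr rfl) hJA hIB hqA hmem))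
    · have hsep' := hsep.mono (Finset.union_subset_union hIB hJA) subset_rfl
      exact absurd hmem (hsep'.notMem_convexHull hd hs (Finset.mem_singleton_self q))
  · intro hc q hq hmem
    rcases Finset.mem_union.1 hq with hqI | hqJ
    · refine hIc hc q hqI (hBA.mem_shadow hd (Or.inl rfl) ((Finset.erase_subset _ _).trans hIB) hJA
        (hIB hqI) (convexHull_mono ?_ hmem))
      intro x hx
      simp only [Finset.coe_erase, Finset.coe_union, Set.mem_sdiff, Set.mem_union,
        Finset.mem_coe, Set.mem_singleton_iff] at hx ⊢
      tauto
    · refine hJc hc q hqJ (hAB.mem_shadow hd (Or.inr rfl) ((Finset.erase_subset _ _).trans hJA) hIB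
        (hJA hqJ) (convexHull_mono ?_ hmem))
      intro x hx
      simp only [Finset.coe_erase, Finset.coe_union, Set.mem_sdiff, Set.mem_union,
        Finset.mem_coe, Set.mem_singleton_iff] at hx ⊢
      tauto

/-- If a finite family can be separated recursively, then two of its members are adjacent. -/
theorem exists_adjacent_pair {d : ℕ} (F : ℕ → Finset (Fin (d + 1) → ℝ)) (I₀ : Finset ℕ)
    (h : ∀ I ⊆ I₀, 2 ≤ I.card → ∃ J ⊆ I, J.Nonempty ∧ (I \ J).Nonempty ∧
      DeepBelow (J.biUnion F) ((I \ J).biUnion F)) (h₀ : 2 ≤ I₀.card) :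
    ∃ i ∈ I₀, ∃ j ∈ I₀, i ≠ j ∧ DeepBelow (F j) (F i) ∧
      ∀ l ∈ I₀, l ≠ i → l ≠ j → ∃ s : ℝ, (s = 1 ∨ s = -1) ∧ Separated s (F j ∪ F i) (F l) := by
  induction I₀ using Finset.strongInduction with
  | H I ih =>
    obtain ⟨J, hJI, hJ, hK, hdeep⟩ := h I subset_rfl h₀
    obtain ⟨hs1, hs2⟩ := hdeep.separated
    -- Recursion into a part `K` with at least two indices: members outside `K` are separated from
    -- the whole union over `K`, hence from the pair found inside.
    have key : ∀ K ⊂ I, 2 ≤ K.card → (∀ l ∈ I, l ∉ K → ∃ s : ℝ, (s = 1 ∨ s = -1) ∧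
        Separated s (K.biUnion F) (F l)) → ∃ i ∈ I, ∃ j ∈ I, i ≠ j ∧ DeepBelow (F j) (F i) ∧
      ∀ l ∈ I, l ≠ i → l ≠ j → ∃ s : ℝ, (s = 1 ∨ s = -1) ∧
        Separated s (F j ∪ F i) (F l) := by
      intro K hKI hKc hsep
      obtain ⟨i, hi, j, hj, hij, hd, hl⟩ := ih K hKI (fun I' hI' => h I' (hI'.trans hKI.1)) hKc
      refine ⟨i, hKI.1 hi, j, hKI.1 hj, hij, hd, fun l hlI hli hlj => ?_⟩
      by_cases hlK : l ∈ K
      · exact hl l hlK hli hlj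
      · obtain ⟨s, hs, hS⟩ := hsep l hlI hlK
        exact ⟨s, hs, hS.mono (Finset.union_subset (Finset.subset_biUnion_of_mem F hj)
          (Finset.subset_biUnion_of_mem F hi)) subset_rfl⟩
    have hJss : J ⊂ I := Finset.ssubset_iff_subset_ne.2
      ⟨hJI, fun h => by simp [h] at hK⟩
    have hKss : I \ J ⊂ I := Finset.ssubset_iff_subset_ne.2
      ⟨Finset.sdiff_subset, fun h => by
        obtain ⟨x, hx⟩ := hJ
        have := hJI hx
        rw [← h] at this
        exact (Finset.mem_sdiff.1 this).2 hx⟩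
    rcases Nat.lt_or_ge 1 J.card with hJc | hJc
    · refine key J hJss hJc fun l hlI hlJ => ⟨1, Or.inl rfl, hs1.mono subset_rfl ?_⟩
      exact Finset.subset_biUnion_of_mem F (Finset.mem_sdiff.2 ⟨hlI, hlJ⟩)
    rcases Nat.lt_or_ge 1 (I \ J).card with hKc | hKc
    · refine key (I \ J) hKss hKc fun l hlI hlJ => ⟨-1, Or.inr rfl, hs2.mono subset_rfl ?_⟩
      exact Finset.subset_biUnion_of_mem F (by simpa [hlI] using hlJ)
    obtain ⟨j, hj⟩ := Finset.card_eq_one.1 (le_antisymm hJc (Finset.card_pos.2 hJ))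
    obtain ⟨i, hi⟩ := Finset.card_eq_one.1 (le_antisymm hKc (Finset.card_pos.2 hK))
    have hiI : i ∈ I \ J := by simp [hi]
    have hjJ : j ∈ J := by simp [hj]
    rw [hi, hj, Finset.singleton_biUnion, Finset.singleton_biUnion] at hdeep
    refine ⟨i, (Finset.mem_sdiff.1 hiI).1, j, hJI hjJ,
      fun h => (Finset.mem_sdiff.1 hiI).2 (h ▸ hjJ), hdeep, fun l hl hli hlj => ?_⟩
    by_cases hlJ : l ∈ J
    · rw [hj] at hlJ
      exact absurd (Finset.mem_singleton.1 hlJ) hlj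
    · have : l ∈ I \ J := Finset.mem_sdiff.2 ⟨hl, hlJ⟩
      rw [hi] at this
      exact absurd (Finset.mem_singleton.1 this) hli

/-! ### Residue classes of Horton sets and their sizes. -/

theorem hortonPrime_two_le (d : ℕ) : 2 ≤ hortonPrime d :=
  (Nat.prime_nth_prime _).two_le

theorem IsHorton.stronglyGeneralPosition {d : ℕ} {H : Finset (Fin (d + 2) → ℝ)}
    (h : IsHorton (d + 2) H) : StronglyGeneralPosition H := by
  cases h <;> assumption

theorem IsHorton.residueClass {d : ℕ} {H : Finset (Fin (d + 2) → ℝ)} (h : IsHorton (d + 2) H)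
    (hc : 2 ≤ H.card) {i : ℕ} (hi : i < hortonPrime (d + 2)) :
    IsHorton (d + 2) (residueClass H i (hortonPrime (d + 2))) := by
  cases h with
  | small _ _ h => omega
  | step _ _ _ hcl _ => exact hcl i hi

theorem IsHorton.image_proj {d : ℕ} {H : Finset (Fin (d + 3) → ℝ)} (h : IsHorton (d + 3) H)
    (hc : 2 ≤ H.card) : IsHorton (d + 2) (H.image proj) := by
  cases h with
  | small _ _ h => omega
  | step _ _ hp _ _ => exact hp (by omega)

theorem IsHorton.exists_adjacent_classes {d : ℕ} {H : Finset (Fin (d + 2) → ℝ)}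
    (h : IsHorton (d + 2) H) (hc : 2 ≤ H.card) :
    ∃ i < hortonPrime (d + 2), ∃ j < hortonPrime (d + 2), i ≠ j ∧
      DeepBelow (HortonSets.residueClass H j (hortonPrime (d + 2)))
        (HortonSets.residueClass H i (hortonPrime (d + 2))) ∧
      ∀ l < hortonPrime (d + 2), l ≠ i → l ≠ j → ∃ s : ℝ, (s = 1 ∨ s = -1) ∧
        Separated s (HortonSets.residueClass H j (hortonPrime (d + 2)) ∪
          HortonSets.residueClass H i (hortonPrime (d + 2)))
          (HortonSets.residueClass H l (hortonPrime (d + 2))) := by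
  cases h with
  | small _ _ h => omega
  | step _ _ _ _ hdeep =>
    simpa using exists_adjacent_pair
      (fun l => HortonSets.residueClass H l (hortonPrime (d + 2))) _ hdeep
      (by simpa using hortonPrime_two_le (d + 2))

theorem rank_lt_rank {d : ℕ} {Q : Finset (Fin (d + 1) → ℝ)} {p q : Fin (d + 1) → ℝ} (hp : p ∈ Q)
    (h : p 0 < q 0) : rank Q p < rank Q q := by
  refine Finset.card_lt_card (Finset.ssubset_iff_of_subset ?_ |>.2 ⟨p, by simp [hp, h], by simp⟩)
  intro x hx
  simp only [Finset.mem_filter] at hx ⊢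
  exact ⟨hx.1, hx.2.trans h⟩

theorem lt_of_rank_lt {d : ℕ} {Q : Finset (Fin (d + 1) → ℝ)} {p q : Fin (d + 1) → ℝ}
    (h : rank Q p < rank Q q) : p 0 < q 0 := by
  by_contra! hle
  refine absurd h (not_lt.2 (Finset.card_le_card ?_))
  intro x hx
  simp only [Finset.mem_filter] at hx ⊢
  exact ⟨hx.1, hx.2.trans_le hle⟩

theorem StronglyGeneralPosition.injOn_rank {d : ℕ} (hd : 1 ≤ d) {Q : Finset (Fin (d + 1) → ℝ)}
    (hQ : StronglyGeneralPosition Q) : Set.InjOn (rank Q) Q := by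
  intro a ha b hb hab
  refine hQ.injOn_zero hd a ha b hb ?_
  rcases lt_trichotomy (a 0) (b 0) with h | h | h
  · exact absurd hab (rank_lt_rank ha h).ne
  · exact h
  · exact absurd hab (rank_lt_rank hb h).ne'

theorem StronglyGeneralPosition.image_rank {d : ℕ} (hd : 1 ≤ d) {Q : Finset (Fin (d + 1) → ℝ)}
    (hQ : StronglyGeneralPosition Q) : Q.image (rank Q) = Finset.range Q.card := by
  refine Finset.eq_of_subset_of_card_le ?_ ?_
  · intro r hr
    obtain ⟨q, hq, rfl⟩ := Finset.mem_image.1 hr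
    rw [Finset.mem_range]
    refine Finset.card_lt_card (Finset.filter_ssubset.2 ⟨q, hq, by simp⟩)
  · rw [Finset.card_image_of_injOn (hQ.injOn_rank hd), Finset.card_range]

theorem StronglyGeneralPosition.exists_rank_eq {d : ℕ} (hd : 1 ≤ d) {Q : Finset (Fin (d + 1) → ℝ)}
    (hQ : StronglyGeneralPosition Q) {r : ℕ} (hr : r < Q.card) : ∃ q ∈ Q, rank Q q = r := by
  have : r ∈ Q.image (rank Q) := by simpa [hQ.image_rank hd] using hr
  simpa using this

theorem StronglyGeneralPosition.div_le_card_residueClass {d : ℕ} (hd : 1 ≤ d)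
    {Q : Finset (Fin (d + 1) → ℝ)} (hQ : StronglyGeneralPosition Q) {i m : ℕ} (hi : i < m) :
    Q.card / m ≤ (residueClass Q i m).card := by
  have hex : ∀ j ∈ Finset.range (Q.card / m), ∃ q ∈ Q, rank Q q = m * j + i := by
    intro j hj
    refine hQ.exists_rank_eq hd ?_
    have h1 : (j + 1) * m ≤ Q.card :=
      (Nat.le_div_iff_mul_le (by omega)).1 (Finset.mem_range.1 hj)
    nlinarith
  choose! f hf hfr using hex
  calc Q.card / m = (Finset.range (Q.card / m)).card := by simp
    _ ≤ _ := by
      refine Finset.card_le_card_of_injOn f (fun j hj => ?_) fun a ha b hb hab => ?_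
      · refine Finset.mem_coe.2 (Finset.mem_filter.2 ⟨hf j hj, ?_⟩)
        rw [hfr j hj, Nat.ModEq, Nat.mul_add_mod]
      · have h1 := hfr a ha
        rw [hab, hfr b hb] at h1
        have : m * b = m * a := by omega
        exact (Nat.eq_of_mul_eq_mul_left (by omega) this).symm

/-! ### Counting: exponents add over two classes. -/

/-- Every Horton set `H` in `ℝ^d` with sufficiently many points `n` has at least a constant times
`n ^ e` subsets `I` of size `k` such that `P H I`. -/
def Many (d : ℕ) (P : Finset (Fin d → ℝ) → Finset (Fin d → ℝ) → Prop) (k e : ℕ) : Prop :=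
  ∃ C : ℝ, 0 < C ∧ ∃ n₀ : ℕ, ∀ H : Finset (Fin d → ℝ), IsHorton d H → n₀ ≤ H.card →
    ∃ F : Finset (Finset (Fin d → ℝ)), (∀ I ∈ F, I.card = k ∧ P H I) ∧
      C * (H.card : ℝ) ^ e ≤ F.card

theorem div_two_mul_le_div {n p : ℕ} (hp : 0 < p) (h : p ≤ n) :
    (n : ℝ) / (2 * p) ≤ ((n / p : ℕ) : ℝ) := by
  have h1 : 1 ≤ n / p := (Nat.one_le_div_iff hp).2 h
  have h2 : n ≤ (n / p) * (2 * p) := by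
    have := Nat.lt_div_mul_add hp (a := n)
    nlinarith
  rw [div_le_iff₀ (by positivity)]
  exact_mod_cast h2

theorem Many.good_of_shadowGood {d : ℕ} {c : Prop} {k₀ k₁ e₀ e₁ : ℕ}
    (h₀ : Many (d + 2) (IsShadowGood 1 c) k₀ e₀) (h₁ : Many (d + 2) (IsShadowGood (-1) c) k₁ e₁) :
    Many (d + 2) (IsGood c) (k₀ + k₁) (e₀ + e₁) := by
  obtain ⟨C₀, hC₀, m₀, h₀⟩ := h₀
  obtain ⟨C₁, hC₁, m₁, h₁⟩ := h₁
  set p := hortonPrime (d + 2) with hp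
  have hp2 : 2 ≤ p := hortonPrime_two_le _
  -- A class has at least `⌊n / p⌋` points, which is at least `n / (2 * p)` when `n ≥ p`. The
  -- threshold ensures this and makes both classes large enough for `h₀` and `h₁`.
  refine ⟨C₀ * C₁ / (2 * p) ^ (e₀ + e₁), by positivity, p * (max m₀ m₁ + 1), fun H hH hn => ?_⟩
  have hpn : p ≤ H.card := (Nat.le_mul_of_pos_right p (Nat.succ_pos _)).trans hn
  have hgp := hH.stronglyGeneralPosition
  obtain ⟨i, hi, j, hj, hij, hdeep, hsep⟩ := hH.exists_adjacent_classes (by omega)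
  have hsize : ∀ l < p, max m₀ m₁ ≤ (residueClass H l p).card ∧
      (H.card : ℝ) / (2 * p) ≤ (residueClass H l p).card := by
    intro l hl
    have h := hgp.div_le_card_residueClass (by omega) hl
    refine ⟨le_trans ?_ h, (div_two_mul_le_div (by omega) hpn).trans (by exact_mod_cast h)⟩
    rw [Nat.le_div_iff_mul_le (by omega)]
    nlinarith
  obtain ⟨F₀, hF₀, hF₀c⟩ := h₀ _ (hH.residueClass (by omega) hj)
    ((le_max_left _ _).trans (hsize j hj).1)
  obtain ⟨F₁, hF₁, hF₁c⟩ := h₁ _ (hH.residueClass (by omega) hi)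
    ((le_max_right _ _).trans (hsize i hi).1)
  rw [← hp] at hF₀ hF₀c hF₁ hF₁c
  have hdisj : Disjoint (residueClass H j p) (residueClass H i p) := by
    rw [Finset.disjoint_left]
    intro x hx hx'
    have h1 : rank H x % p = j % p := (Finset.mem_filter.1 hx).2
    have h2 : rank H x % p = i % p := (Finset.mem_filter.1 hx').2
    rw [Nat.mod_eq_of_lt hj] at h1
    rw [Nat.mod_eq_of_lt hi] at h2
    exact hij (h2.symm.trans h1)
  -- The classes are disjoint, so a union determines its two parts.
  have hinj : Set.InjOn (fun x : Finset (Fin (d + 2) → ℝ) × Finset (Fin (d + 2) → ℝ) => x.1 ∪ x.2)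
      (F₀ ×ˢ F₁ : Finset _) := by
    rintro ⟨I, J⟩ hIJ ⟨I', J'⟩ hIJ' heq
    simp only [Finset.coe_product, Set.mem_prod, Finset.mem_coe] at hIJ hIJ' heq
    have a1 := (hF₀ I hIJ.1).2.1
    have a2 := (hF₁ J hIJ.2).2.1
    have a3 := (hF₀ I' hIJ'.1).2.1
    have a4 := (hF₁ J' hIJ'.2).2.1
    rw [Finset.disjoint_left] at hdisj
    rw [Finset.ext_iff] at heq
    simp only [Finset.mem_union] at heq
    refine Prod.ext (Finset.ext fun x => ⟨fun hx => ?_, fun hx => ?_⟩)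
      (Finset.ext fun x => ⟨fun hx => ?_, fun hx => ?_⟩)
    · exact ((heq x).1 (Or.inl hx)).resolve_right fun h => hdisj (a1 hx) (a4 h)
    · exact ((heq x).2 (Or.inl hx)).resolve_right fun h => hdisj (a3 hx) (a2 h)
    · exact ((heq x).1 (Or.inr hx)).resolve_left fun h => hdisj (a3 h) (a2 hx)
    · exact ((heq x).2 (Or.inr hx)).resolve_left fun h => hdisj (a1 h) (a4 hx)
  refine ⟨(F₀ ×ˢ F₁).image fun x => x.1 ∪ x.2, ?_, ?_⟩
  · intro K hK
    obtain ⟨⟨I, J⟩, hIJ, rfl⟩ := Finset.mem_image.1 hK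
    obtain ⟨hI, hJ⟩ := Finset.mem_product.1 hIJ
    obtain ⟨hIc, hIg⟩ := hF₀ I hI
    obtain ⟨hJc, hJg⟩ := hF₁ J hJ
    refine ⟨?_, hdeep.isGood_union (by omega) (Finset.filter_subset _ _)
      (Finset.filter_subset _ _) (fun q hq => ?_) hIg hJg⟩
    · rw [Finset.card_union_of_disjoint (hdisj.mono hIg.1 hJg.1), hIc, hJc]
    · have hql : q ∈ residueClass H (rank H q % p) p :=
        Finset.mem_filter.2 ⟨hq, (Nat.mod_modEq _ _).symm⟩
      by_cases hqj : rank H q % p = j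
      · exact Or.inl (hqj ▸ hql)
      by_cases hqi : rank H q % p = i
      · exact Or.inr (Or.inl (hqi ▸ hql))
      obtain ⟨s, hs, hS⟩ := hsep _ (Nat.mod_lt _ (by omega)) hqi hqj
      exact Or.inr (Or.inr ⟨s, hs, hS.mono subset_rfl (Finset.singleton_subset_iff.2 hql)⟩)
  · rw [Finset.card_image_of_injOn hinj, Finset.card_product, Nat.cast_mul]
    calc C₀ * C₁ / (2 * p) ^ (e₀ + e₁) * (H.card : ℝ) ^ (e₀ + e₁)
        = (C₀ * ((H.card : ℝ) / (2 * p)) ^ e₀) * (C₁ * ((H.card : ℝ) / (2 * p)) ^ e₁) := by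
          rw [div_pow, div_pow, pow_add, pow_add]
          field_simp
      _ ≤ (C₀ * ((residueClass H j p).card : ℝ) ^ e₀) *
          (C₁ * ((residueClass H i p).card : ℝ) ^ e₁) := by
          have := (hsize i hi).2
          have := (hsize j hj).2
          gcongr
      _ ≤ _ := mul_le_mul hF₀c hF₁c (by positivity) (by positivity)

/-! ### Lifting from the projection. -/

theorem proj_mem_convexHull {d : ℕ} {s : ℝ} {I : Set (Fin (d + 1) → ℝ)} {q : Fin (d + 1) → ℝ}
    (h : q ∈ shadow s (convexHull ℝ I)) : proj q ∈ convexHull ℝ (proj '' I) := by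
  obtain ⟨y, hy, hyq, -⟩ := h
  have hlin : (proj : (Fin (d + 1) → ℝ) → _) = LinearMap.funLeft ℝ ℝ Fin.castSucc := rfl
  rw [← hyq, hlin, ← LinearMap.image_convexHull]
  exact Set.mem_image_of_mem _ hy

/-- Shadows of a hull project into the hull of the projection, so the part of `H` over a good set is
shadow-good for any `s`. Distinct first coordinates make the projection injective on `H`. -/
theorem Many.shadowGood_of_good {d : ℕ} {c : Prop} {k e : ℕ} (s : ℝ)
    (h : Many (d + 2) (IsGood c) k e) : Many (d + 3) (IsShadowGood s c) k e := by
  obtain ⟨C, hC, n₀, h⟩ := h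
  refine ⟨C, hC, max n₀ 2, fun H hH hn => ?_⟩
  have hinj : Set.InjOn proj (H : Set (Fin (d + 3) → ℝ)) := fun a ha b hb hab =>
    hH.stronglyGeneralPosition.injOn_zero (by omega) a ha b hb (by simpa [proj] using congrFun hab 0)
  have hcard : (H.image proj).card = H.card := Finset.card_image_of_injOn hinj
  obtain ⟨F, hF, hFc⟩ := h _ (hH.image_proj ((le_max_right _ _).trans hn))
    (by rw [hcard]; exact (le_max_left _ _).trans hn)
  have himage : ∀ K ∈ F, (H.filter fun q => proj q ∈ K).image proj = K := by
    intro K hK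
    ext x
    simp only [Finset.mem_image, Finset.mem_filter]
    constructor
    · rintro ⟨q, ⟨-, hq⟩, rfl⟩
      exact hq
    · intro hx
      obtain ⟨q, hq, rfl⟩ := Finset.mem_image.1 ((hF K hK).2.1 hx)
      exact ⟨q, ⟨hq, hx⟩, rfl⟩
  have hinjF : Set.InjOn (fun K => H.filter fun q => proj q ∈ K)
      (F : Set (Finset (Fin (d + 2) → ℝ))) := by
    intro K hK K' hK' heq
    simp only at heq
    rw [← himage K hK, heq, himage K' hK']
  refine ⟨F.image fun K => H.filter fun q => proj q ∈ K, ?_, ?_⟩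
  · intro I hI
    obtain ⟨K, hK, rfl⟩ := Finset.mem_image.1 hI
    obtain ⟨hKc, -, hKi, hKconv⟩ := hF K hK
    refine ⟨?_, Finset.filter_subset _ _, fun q hq hqs => ?_, fun hc q hq hqs => ?_⟩
    · have hfc := Finset.card_image_of_injOn
        (hinj.mono (Finset.coe_subset.2 (Finset.filter_subset (fun q => proj q ∈ K) H)))
      rw [himage K hK] at hfc
      exact hfc.symm.trans hKc
    · have := proj_mem_convexHull hqs
      rw [← Finset.coe_image, himage K hK] at this
      exact Finset.mem_filter.2 ⟨hq, hKi _ (Finset.mem_image_of_mem _ hq) this⟩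
    · obtain ⟨hqH, hqK⟩ := Finset.mem_filter.1 hq
      refine hKconv hc _ hqK (convexHull_mono ?_ (proj_mem_convexHull hqs))
      rintro _ ⟨x, hx, rfl⟩
      obtain ⟨hxq, hx⟩ := Finset.mem_erase.1 hx
      obtain ⟨hxH, hxK⟩ := Finset.mem_filter.1 hx
      exact Finset.mem_erase.2 ⟨fun h => hxq (hinj hxH hqH h), hxK⟩
  · rw [Finset.card_image_of_injOn hinjF]
    rwa [hcard] at hFc

/-! ### The planar base case. -/

theorem exists_zero_eq_of_mem_shadow {s : ℝ} {I : Set (Fin 2 → ℝ)} {q : Fin 2 → ℝ}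
    (h : q ∈ shadow s (convexHull ℝ I)) : (∃ x ∈ I, x 0 ≤ q 0) ∧ ∃ x ∈ I, q 0 ≤ x 0 := by
  obtain ⟨y, hy, hyq, -⟩ := h
  have h0 : y 0 = q 0 := congrFun hyq 0
  constructor
  · by_contra! hI
    have : y ∈ {x : Fin 2 → ℝ | q 0 < x 0} :=
      convexHull_min hI (convex_halfSpace_gt (LinearMap.proj (R := ℝ) (0 : Fin 2)).isLinear _) hy
    exact absurd this (by simp [h0])
  · by_contra! hI
    have : y ∈ {x : Fin 2 → ℝ | x 0 < q 0} :=
      convexHull_min hI (convex_halfSpace_lt (LinearMap.proj (R := ℝ) (0 : Fin 2)).isLinear _) hy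
    exact absurd this (by simp [h0])

/-- The `k` points of `H` that follow the first `t` points. -/
noncomputable def block {d : ℕ} (H : Finset (Fin (d + 1) → ℝ)) (t k : ℕ) :
    Finset (Fin (d + 1) → ℝ) :=
  H.filter fun q => t ≤ rank H q ∧ rank H q < t + k

theorem StronglyGeneralPosition.card_block {d : ℕ} (hd : 1 ≤ d) {H : Finset (Fin (d + 1) → ℝ)}
    (hH : StronglyGeneralPosition H) {t k : ℕ} (ht : t + k ≤ H.card) : (block H t k).card = k := by
  have : (block H t k).image (rank H) = Finset.Ico t (t + k) := by
    ext r
    simp only [block, Finset.mem_image, Finset.mem_filter, Finset.mem_Ico]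
    constructor
    · rintro ⟨q, ⟨-, hq⟩, rfl⟩
      exact hq
    · intro hr
      obtain ⟨q, hq, rfl⟩ := hH.exists_rank_eq hd (show r < H.card by omega)
      exact ⟨q, ⟨hq, hr⟩, rfl⟩
  have hinj : Set.InjOn (rank H) (block H t k) :=
    (hH.injOn_rank hd).mono (Finset.coe_subset.2 (Finset.filter_subset _ H))
  rw [← Finset.card_image_of_injOn hinj, this]
  simp

/-- A shadow stays within the range of first coordinates, so consecutive points form a shadow
island. Among at most three, only the middle one can lie in the shadow of the rest; it belongs to
`B` and the outer ones to `A`, which excludes this. -/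
theorem isShadowGood_block {s : ℝ} (hs : s = 1 ∨ s = -1) {c : Prop} {k : ℕ}
    (hk : c → k ≤ 3) {H : Finset (Fin 2 → ℝ)} (hH : StronglyGeneralPosition H)
    {A B : Finset (Fin 2 → ℝ)}
    (hsep : Separated (-s) A B) {t : ℕ}
    (hB : ∀ q ∈ H, rank H q = t + 1 → q ∈ B)
    (hA : ∀ q ∈ H, rank H q = t ∨ rank H q = t + 2 → q ∈ A) :
    IsShadowGood s c H (block H t k) := by
  refine ⟨Finset.filter_subset _ _, fun q hq hqs => ?_, fun hc q hq hqs => ?_⟩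
  · obtain ⟨⟨x, hx, hxq⟩, y, hy, hyq⟩ := exists_zero_eq_of_mem_shadow hqs
    obtain ⟨hxH, hx1, hx2⟩ := Finset.mem_filter.1 hx
    obtain ⟨hyH, hy1, hy2⟩ := Finset.mem_filter.1 hy
    refine Finset.mem_filter.2 ⟨hq, ?_, ?_⟩
    · by_contra! hlt
      have := lt_of_rank_lt (hlt.trans_le hx1)
      linarith
    · by_contra! hlt
      have := lt_of_rank_lt (hy2.trans_le hlt)
      linarith
  · obtain ⟨⟨x, hx, hxq⟩, y, hy, hyq⟩ := exists_zero_eq_of_mem_shadow hqs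
    obtain ⟨hxne, hx⟩ := Finset.mem_erase.1 hx
    obtain ⟨hyne, hy⟩ := Finset.mem_erase.1 hy
    obtain ⟨hxH, hx1, hx2⟩ := Finset.mem_filter.1 hx
    obtain ⟨hyH, hy1, hy2⟩ := Finset.mem_filter.1 hy
    obtain ⟨hqH, hq1, hq2⟩ := Finset.mem_filter.1 hq
    have hxq' : rank H x < rank H q :=
      rank_lt_rank hxH (lt_of_le_of_ne hxq fun h => hxne (hH.injOn_zero le_rfl _ hxH _ hqH h))
    have hyq' : rank H q < rank H y :=
      rank_lt_rank hqH (lt_of_le_of_ne hyq fun h => hyne (hH.injOn_zero le_rfl _ hyH _ hqH h.symm))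
    have hk3 := hk hc
    have hqr : rank H q = t + 1 := by omega
    have hnot := hsep.notMem_shadow le_rfl (by rcases hs with rfl | rfl <;> simp) (hB q hqH hqr)
    rw [neg_neg] at hnot
    obtain ⟨z, hz, hzq⟩ := hqs
    refine hnot ⟨z, convexHull_mono ?_ hz, hzq⟩
    intro w hw
    obtain ⟨hwne, hw⟩ := Finset.mem_erase.1 hw
    obtain ⟨hwH, hw1, hw2⟩ := Finset.mem_filter.1 hw
    refine hA w hwH ?_
    have : rank H w ≠ rank H q := fun h => hwne (hH.injOn_rank le_rfl hwH hqH h)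
    omega

theorem hortonPrime_two : hortonPrime 2 = 2 := by
  simp [hortonPrime]

theorem many_shadowGood_two {s : ℝ} (hs : s = 1 ∨ s = -1) {c : Prop} {k : ℕ} (hk : c → k ≤ 3) :
    Many 2 (IsShadowGood s c) k (min 1 k) := by
  refine ⟨1 / 4, by norm_num, 2 * k + 4, fun H hH hn => ?_⟩
  have hgp := hH.stronglyGeneralPosition
  obtain ⟨i, hi, j, hj, hij, hdeep, -⟩ := hH.exists_adjacent_classes (by omega)
  simp only [zero_add, hortonPrime_two] at hi hj hdeep
  obtain ⟨hs1, hs2⟩ := hdeep.separated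
  -- Since `p_2 = 2`, classes are parities. Blocks start at parity `a`, so that their second point
  -- lies in the class on the side opposite to the shadow direction.
  obtain ⟨a, b, hab, hsep⟩ : ∃ a b, a + b = 1 ∧
      Separated (-s) (residueClass H a 2) (residueClass H b 2) := by
    rcases hs with rfl | rfl
    · exact ⟨i, j, by omega, hs2⟩
    · exact ⟨j, i, by omega, by simpa using hs1⟩
  have hgood : ∀ u, IsShadowGood s c H (block H (2 * u + a) k) := fun u =>
    isShadowGood_block hs hk hgp hsep
      (fun q hq h => Finset.mem_filter.2 ⟨hq, by rw [Nat.ModEq]; omega⟩)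
      (fun q hq h => Finset.mem_filter.2 ⟨hq, by rw [Nat.ModEq]; omega⟩)
  rcases Nat.eq_zero_or_pos k with rfl | hkpos
  · refine ⟨{block H (2 * 0 + a) 0}, ?_, by norm_num⟩
    intro I hI
    rw [Finset.mem_singleton.1 hI]
    exact ⟨hgp.card_block le_rfl (by omega), hgood 0⟩
  have hinj : Set.InjOn (fun u => block H (2 * u + a) k)
      (Finset.range ((H.card - k) / 2) : Set ℕ) := by
    have hmem : ∀ u ∈ Finset.range ((H.card - k) / 2), ∀ v,
        block H (2 * u + a) k = block H (2 * v + a) k → v ≤ u := by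
      intro u hu v huv
      obtain ⟨q, hq, hqr⟩ := hgp.exists_rank_eq le_rfl
        (show 2 * u + a < H.card by have := Finset.mem_range.1 hu; omega)
      have hq' : q ∈ block H (2 * u + a) k := Finset.mem_filter.2 ⟨hq, by omega, by omega⟩
      rw [huv] at hq'
      have := (Finset.mem_filter.1 hq').2.1
      omega
    intro u hu v hv huv
    exact le_antisymm (hmem v hv u huv.symm) (hmem u hu v huv)
  refine ⟨(Finset.range ((H.card - k) / 2)).image fun u => block H (2 * u + a) k, ?_, ?_⟩
  · intro I hI
    obtain ⟨u, hu, rfl⟩ := Finset.mem_image.1 hI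
    have := Finset.mem_range.1 hu
    exact ⟨hgp.card_block le_rfl (by omega), hgood u⟩
  · rw [Finset.card_image_of_injOn hinj, Finset.card_range, min_eq_left hkpos, pow_one]
    have : H.card ≤ 4 * ((H.card - k) / 2) := by omega
    have : (H.card : ℝ) ≤ 4 * (((H.card - k) / 2 : ℕ) : ℝ) := by exact_mod_cast this
    linarith

/-! ### Induction on the dimension. -/

/-- Splitting `k` evenly keeps both parts within the size bound and makes the two minima add up
exactly. -/
theorem many_good_of_many_shadowGood {d : ℕ} {c : Prop}
    (h : ∀ s : ℝ, s = 1 ∨ s = -1 → ∀ k, (c → k ≤ 3 * 2 ^ d) →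
      Many (d + 2) (IsShadowGood s c) k (min (2 ^ d) k)) {k : ℕ} (hk : c → k ≤ 3 * 2 ^ (d + 1)) :
    Many (d + 2) (IsGood c) k (min (2 ^ (d + 1)) k) := by
  rw [pow_succ] at hk ⊢
  have := (h 1 (Or.inl rfl) (k / 2) fun hc => by have := hk hc; omega).good_of_shadowGood
    (h (-1) (Or.inr rfl) (k - k / 2) fun hc => by have := hk hc; omega)
  rwa [show k / 2 + (k - k / 2) = k by omega,
    show min (2 ^ d) (k / 2) + min (2 ^ d) (k - k / 2) = min (2 ^ d * 2) k by omega] at this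

theorem many_shadowGood (d : ℕ) {c : Prop} {s : ℝ} (hs : s = 1 ∨ s = -1) {k : ℕ}
    (hk : c → k ≤ 3 * 2 ^ d) : Many (d + 2) (IsShadowGood s c) k (min (2 ^ d) k) := by
  induction d generalizing s k with
  | zero => simpa using many_shadowGood_two hs (by simpa using hk)
  | succ d ih =>
    exact (many_good_of_many_shadowGood (fun s hs k hk => ih hs hk) hk).shadowGood_of_good s

theorem many_good (d : ℕ) {c : Prop} {k : ℕ} (hk : c → k ≤ 3 * 2 ^ (d + 1)) :
    Many (d + 2) (IsGood c) k (min (2 ^ (d + 1)) k) :=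
  many_good_of_many_shadowGood (fun _ hs _ hk => many_shadowGood d hs hk) hk

/-! ### From good sets to islands and holes. -/

theorem IsGood.isIsland {d k : ℕ} {c : Prop} {S I : Finset (Fin d → ℝ)} (h : IsGood c S I)
    (hk : I.card = k) : IsIsland k S I := by
  refine ⟨h.1, hk, Set.Subset.antisymm ?_ ?_⟩
  · rintro q ⟨hq, hqS⟩
    exact h.2.1 q hqS hq
  · exact fun q hq => ⟨subset_convexHull ℝ _ hq, h.1 hq⟩

/-- A point of `S` in the hull belongs to `I`; by convex position it is an extreme point, hence not
interior. -/
theorem IsGood.isHole {d k : ℕ} {S I : Finset (Fin (d + 1) → ℝ)} (h : IsGood True S I)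
    (hk : I.card = k) : IsHole k S I := by
  have hci : ∀ q ∈ I, q ∉ convexHull ℝ ((I : Set (Fin (d + 1) → ℝ)) \ {q}) := fun q hq => by
    simpa using h.2.2 trivial q hq
  refine ⟨h.1, hk, convexIndependent_set_iff_notMem_convexHull_sdiff.2 hci, ?_⟩
  rw [Set.eq_empty_iff_forall_notMem]
  rintro q ⟨hqi, hqS⟩
  have hqI := h.2.1 q hqS (interior_subset hqi)
  refine (Set.disjoint_left.1 (disjoint_interior_extremePoints _) hqi) ?_
  -- If `q` were not extreme, Krein–Milman would put it in the hull of the other points of `I`.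
  by_contra hext
  have hsub : (convexHull ℝ (I : Set (Fin (d + 1) → ℝ))).extremePoints ℝ ⊆ I.erase q :=
    fun x hx => Finset.mem_coe.2 (Finset.mem_erase.2
      ⟨fun h => hext (h ▸ hx), extremePoints_convexHull_subset hx⟩)
  have hmem := closure_mono (convexHull_mono hsub)
    ((closure_convexHull_extremePoints (I.finite_toSet.isCompact_convexHull ℝ)
      (convex_convexHull ℝ _)).ge (interior_subset hqi))
  rw [((I.erase q).finite_toSet.isClosed_convexHull ℝ).closure_eq] at hmem
  exact h.2.2 trivial q hqI hmem

end HortonSets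

theorem theorem5 (d k : ℕ) (hd : 2 ≤ d) (hk : 1 ≤ k) :
    (∃ c : ℝ, 0 < c ∧ ∃ n₀ : ℕ, ∀ n : ℕ, n₀ ≤ n →
      ∀ H : Finset (Fin d → ℝ), HortonSets.IsHorton d H → H.card = n →
        c * (n : ℝ) ^ (min (2 ^ (d - 1)) k) ≤ (HortonSets.numIslands k H : ℝ)) ∧
    (k ≤ 3 * 2 ^ (d - 1) →
      ∃ c : ℝ, 0 < c ∧ ∃ n₀ : ℕ, ∀ n : ℕ, n₀ ≤ n →
        ∀ H : Finset (Fin d → ℝ), HortonSets.IsHorton d H → H.card = n →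
          c * (n : ℝ) ^ (min (2 ^ (d - 1)) k) ≤ (HortonSets.numHoles k H : ℝ)) := by
  classical
  obtain ⟨d, rfl⟩ : ∃ e, d = e + 2 := ⟨d - 2, by omega⟩
  constructor
  -- Without convex position there is no bound on `k`.
  · obtain ⟨C, hC, n₀, h⟩ := HortonSets.many_good d (c := False) (k := k) False.elim
    refine ⟨C, hC, n₀, ?_⟩
    rintro _ hn H hH rfl
    obtain ⟨F, hF, hFc⟩ := h H hH hn
    refine hFc.trans (Nat.cast_le.2 (Finset.card_le_card fun I hI => ?_))
    exact Finset.mem_filter.2 ⟨Finset.mem_powerset.2 (hF I hI).2.1,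
      (hF I hI).2.isIsland (hF I hI).1⟩
  · intro hk3
    obtain ⟨C, hC, n₀, h⟩ := HortonSets.many_good d (c := True) (k := k) fun _ => hk3
    refine ⟨C, hC, n₀, ?_⟩
    rintro _ hn H hH rfl
    obtain ⟨F, hF, hFc⟩ := h H hH hn
    refine hFc.trans (Nat.cast_le.2 (Finset.card_le_card fun I hI => ?_))
    exact Finset.mem_filter.2 ⟨Finset.mem_powerset.2 (hF I hI).2.1,
      (hF I hI).2.isHole (hF I hI).1⟩
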